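/- Conventions. A domain in $\mathbb{C}^n$ is a nonempty connected open set; $D\subset\mathbb{C}^n$ is balanced if $\zeta z\in D$ whenever $z\in D$, $\zeta\in\mathbb{C}$, $|\zeta|\le 1$. $\mathrm{Aut}(D)$ is the group of biholomorphic self-maps of $D$, with the compact-open topology. A boundary orbit-accumulation point of $D$ is a point $p\in\partial D$ for which there are $a\in D$ and $\phi_k\in\mathrm{Aut}(D)$, $k=1,2,\dots$, with $\phi_k(a)\to p$. A point $p\in\partial D$ is a peak point of $D$ if there is a continuous $h:\overline D\to\mathbb{C}$, holomorphic on $D$, with $h(p)=1$ and $|h(z)|<1$ for all $z\in\overline D\setminus\{p\}$. A bounded symmetric domain is a bounded domain $D$ such that each $a\in D$ is an isolated fixed point of some involutive automorphism of $D$. Theorem 1.2. Let $D_1$ be a bounded convex balanced domain in $\mathbb{C}^n$ whose automorphism group is noncompact, and let $p$ be a boundary orbit-accumulation point of $D_1$. Let $D_2\subset\mathbb{C}^n$ be a bounded symmetric domain that is convex and balanced. Assume that there are an open neighbourhood $U$ of $p$ and a map $F:U\to\mathbb{C}^n$, biholomorphic onto its open image $F(U)$, such that $F(U\cap D_1)\subset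 D_2$ and $F(U\cap\partial D_1)\subset\partial D_2$. Assume that $p$ is a peak point of $D_1$ or $F(p)$ is a peak point of $D_2$. Then there exists a $\mathbb{C}$-linear map $\mathbb{C}^n\to\mathbb{C}^n$ that maps $D_1$ biholomorphically onto $D_2$. -/

import Mathlib

open Set Filter Topology

/-- A domain in `ℂⁿ`: a nonempty connected open set. -/
structure IsDomainIn {n : ℕ} (D : Set (EuclideanSpace ℂ (Fin n))) : Prop where
  isOpen : IsOpen D
  isConnected : IsConnected D

/-- A bounded convex balanced domain in `ℂⁿ`; `Balanced ℂ D` says that `ζ • z ∈ D` for all `z ∈ D`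
and all `ζ` in the closed unit disc of `ℂ`. -/
structure IsBoundedConvexBalancedDomain {n : ℕ} (D : Set (EuclideanSpace ℂ (Fin n))) : Prop where
  isDomainIn : IsDomainIn D
  isBounded : Bornology.IsBounded D
  convex : Convex ℝ D
  balanced : Balanced ℂ D

/-- `f` restricts to a biholomorphic map of the open set `U` onto the open set `V`: it is
holomorphic on `U` and has a holomorphic two-sided inverse `g : V → U`. The values of `f` off `U`
play no role. -/
def IsBiholomorphism {n : ℕ} (f : EuclideanSpace ℂ (Fin n) → EuclideanSpace ℂ (Fin n))
    (U V : Set (EuclideanSpace ℂ (Fin n))) : Prop :=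
  IsOpen U ∧ IsOpen V ∧ DifferentiableOn ℂ f U ∧ MapsTo f U V ∧
    ∃ g : EuclideanSpace ℂ (Fin n) → EuclideanSpace ℂ (Fin n),
      DifferentiableOn ℂ g V ∧ MapsTo g V U ∧ InvOn g f U V

/-- The automorphism group of `D`, as a set of continuous self-maps of `D`. The type `C(D, D)`
carries the compact-open topology. -/
def automorphisms {n : ℕ} (D : Set (EuclideanSpace ℂ (Fin n))) : Set C(D, D) :=
  {φ | ∃ f : EuclideanSpace ℂ (Fin n) → EuclideanSpace ℂ (Fin n),
    IsBiholomorphism f D D ∧ ∀ z : D, (φ z : EuclideanSpace ℂ (Fin n)) = f z}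

/-- A bounded symmetric domain: a bounded domain `D` such that each `a ∈ D` is an isolated fixed
point of an involutive automorphism of `D`. -/
structure IsBoundedSymmetricDomain {n : ℕ} (D : Set (EuclideanSpace ℂ (Fin n))) : Prop where
  isDomainIn : IsDomainIn D
  isBounded : Bornology.IsBounded D
  symmetric : ∀ a ∈ D, ∃ s : EuclideanSpace ℂ (Fin n) → EuclideanSpace ℂ (Fin n),
    IsBiholomorphism s D D ∧ (∀ z ∈ D, s (s z) = z) ∧ s a = a ∧ ∀ᶠ z in 𝓝[≠] a, s z ≠ z

/-- `p` is a boundary orbit-accumulation point of `D`: a boundary point that is the limit of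
`φ k a` for some `a ∈ D` and some sequence of automorphisms `φ k` of `D`. -/
def IsBoundaryOrbitAccumulationPoint {n : ℕ} (D : Set (EuclideanSpace ℂ (Fin n)))
    (p : EuclideanSpace ℂ (Fin n)) : Prop :=
  p ∈ frontier D ∧ ∃ a ∈ D, ∃ φ : ℕ → EuclideanSpace ℂ (Fin n) → EuclideanSpace ℂ (Fin n),
    (∀ k, IsBiholomorphism (φ k) D D) ∧ Tendsto (fun k => φ k a) atTop (𝓝 p)

/-- `p` is a peak point of `D`: a boundary point with a peak function `h`, holomorphic on `D` and
continuous on `closure D`. -/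
def IsPeakPoint {n : ℕ} (D : Set (EuclideanSpace ℂ (Fin n)))
    (p : EuclideanSpace ℂ (Fin n)) : Prop :=
  p ∈ frontier D ∧ ∃ h : EuclideanSpace ℂ (Fin n) → ℂ,
    DifferentiableOn ℂ h D ∧ ContinuousOn h (closure D) ∧ h p = 1 ∧
      ∀ z ∈ closure D, z ≠ p → ‖h z‖ < 1

/-! The proof is a scaling argument. Let `φ k` be automorphisms of `D₁` carrying an orbit to `p`. A
local peak function at `p` or at `F p` can be transported by `F` or its inverse, so both points are
local peak points. By the maximum principle the whole sequence `φ k` then tends to `p` locally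
uniformly (`IsLocalPeakFunction.tendsto_prod`), and `F ∘ φ k` is eventually defined near each point
of `D₁`.

The domain `D₂` is homogeneous (`exists_automorphism_zero_eq`), so there are automorphisms `ψ k` of
`D₂` with `ψ k 0 = F (φ k 0)`. They tend to the local peak point `F p` in the same way. The maps `(ψ
k)⁻¹ ∘ F ∘ φ k` fix the origin and have asymptotic inverses `(φ k)⁻¹ ∘ F⁻¹ ∘ ψ k`. Montel's theorem
and convexity give a biholomorphic limit `D₁ → D₂` fixing the origin (`exists_biholomorphic_limit`).
By the Schwarz lemma its derivative at the origin already maps `D₁` onto `D₂`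
(`exists_linear_isBiholomorphism`).

Limits are taken along a nonprincipal ultrafilter, which removes all passages to subsequences. -/

section NormedSpaces

variable {E F : Type*} [NormedAddCommGroup E] [NormedSpace ℂ E]
  [NormedAddCommGroup F] [NormedSpace ℂ F]

/-! ### Cauchy and Schwarz estimates for bounded holomorphic maps -/

theorem norm_sub_le_of_bounded_ball {f : E → F} {c z : E} {R M : ℝ}
    (hd : DifferentiableOn ℂ f (Metric.ball c R)) (hM : ∀ w ∈ Metric.ball c R, ‖f w‖ ≤ M)
    (hz : z ∈ Metric.ball c R) : ‖f z - f c‖ ≤ 2 * M / R * ‖z - c‖ := by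
  have hR : 0 < R := Metric.nonempty_ball.1 ⟨z, hz⟩
  have := Complex.dist_le_div_mul_dist_of_mapsTo_ball (R₂ := 2 * M) hd (fun w hw => ?_) hz
  · simpa [dist_eq_norm] using this
  · rw [Metric.mem_closedBall, dist_eq_norm]
    linarith [norm_sub_le (f w) (f c), hM w hw, hM c (Metric.mem_ball_self hR)]

theorem norm_fderiv_le_of_bounded_ball {f : E → F} {c : E} {R M : ℝ} (hR : 0 < R)
    (hd : DifferentiableOn ℂ f (Metric.ball c R)) (hM : ∀ w ∈ Metric.ball c R, ‖f w‖ ≤ M) :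
    ‖fderiv ℂ f c‖ ≤ 2 * M / R := by
  refine Complex.norm_fderiv_le_div_of_mapsTo_ball hd (fun w hw => ?_) hR
  rw [Metric.mem_closedBall, dist_eq_norm]
  linarith [norm_sub_le (f w) (f c), hM w hw, hM c (Metric.mem_ball_self hR)]

/-- A second order Taylor estimate for bounded holomorphic maps on a ball. -/
theorem norm_sub_sub_fderiv_le {f : E → F} {c z : E} {R M : ℝ}
    (hd : DifferentiableOn ℂ f (Metric.ball c R)) (hM : ∀ w ∈ Metric.ball c R, ‖f w‖ ≤ M)
    (hz : z ∈ Metric.ball c R) :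
    ‖f z - f c - fderiv ℂ f c (z - c)‖ ≤ 4 * M * (‖z - c‖ / R) ^ 2 := by
  have hR : 0 < R := Metric.nonempty_ball.1 ⟨z, hz⟩
  have hc : c ∈ Metric.ball c R := Metric.mem_ball_self hR
  have hM0 : 0 ≤ M := (norm_nonneg _).trans (hM c hc)
  have hda : DifferentiableAt ℂ f c := hd.differentiableAt (Metric.isOpen_ball.mem_nhds hc)
  -- Removing the linear part leaves a map whose increments at `c` vanish to second order, so the
  -- higher order Schwarz lemma applies. The radius `4 * M` is `2 * M` for `f - f c` plus `2 * M`
  -- for the linear part.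
  have key := Complex.dist_le_mul_div_pow_of_mapsTo_ball_of_isLittleO
    (f := fun w => f w - fderiv ℂ f c (w - c)) (c := c) (z := z) (R₁ := R) (R₂ := 4 * M) (n := 1)
    (hd.sub ((fderiv ℂ f c).differentiable.comp (differentiable_id.sub_const c)).differentiableOn)
    (fun w hw => ?_) ?_ hz
  · simp only [sub_self, map_zero, sub_zero, dist_eq_norm] at key
    rwa [sub_right_comm] at key
  · have h1 := norm_sub_le_of_bounded_ball hd hM hw
    have h2 := (fderiv ℂ f c).le_of_opNorm_le (norm_fderiv_le_of_bounded_ball hR hd hM) (w - c)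
    have h3 : 2 * M / R * ‖w - c‖ ≤ 2 * M := by
      rw [div_mul_eq_mul_div, div_le_iff₀ hR]
      have : ‖w - c‖ ≤ R := by simpa [dist_eq_norm] using (Metric.mem_ball.1 hw).le
      gcongr
    simp only [sub_self, map_zero, sub_zero, Metric.mem_closedBall, dist_eq_norm]
    rw [sub_right_comm]
    linarith [norm_sub_le (f w - f c) (fderiv ℂ f c (w - c))]
  · have := hda.hasFDerivAt.isLittleO
    simp only [sub_self, map_zero, sub_zero, pow_one]
    refine (this.norm_right).congr_left fun w => ?_
    abel

/-- The remainder after the linear part is `O(ρ ^ 2)` on the ball of radius `ρ`, so the Schwarz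
lemma makes it `O(ρ)`-Lipschitz on a smaller ball. Strictness is what the inverse function theorem
needs. -/
theorem hasStrictFDerivAt_of_differentiableOn_of_bounded {f : E → F} {c : E} {R M : ℝ} (hR : 0 < R)
    (hd : DifferentiableOn ℂ f (Metric.ball c R)) (hM : ∀ w ∈ Metric.ball c R, ‖f w‖ ≤ M) :
    HasStrictFDerivAt f (fderiv ℂ f c) c := by
  have hM0 : 0 ≤ M := (norm_nonneg _).trans (hM c (Metric.mem_ball_self hR))
  refine HasStrictFDerivAt.of_isLittleO (Asymptotics.isLittleO_iff.2 fun ε hε => ?_)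
  set C := 4 * M / R ^ 2 with hC
  have hC0 : 0 ≤ C := by positivity
  obtain ⟨ρ, hρ0, hρR, hρε⟩ : ∃ ρ > 0, ρ < R ∧ 4 * C * ρ ≤ ε := by
    refine ⟨min (R / 2) (ε / (4 * C + 1)), by positivity, ?_, ?_⟩
    · exact (min_le_left _ _).trans_lt (by linarith)
    · calc 4 * C * min (R / 2) (ε / (4 * C + 1)) ≤ (4 * C + 1) * (ε / (4 * C + 1)) := by
            gcongr
            · linarith
            · exact min_le_right _ _
        _ = ε := by field_simp
  set g : E → F := fun w => f w - fderiv ℂ f c (w - c) with hg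
  have hgd : DifferentiableOn ℂ g (Metric.ball c R) :=
    hd.sub ((fderiv ℂ f c).differentiable.comp (differentiable_id.sub_const c)).differentiableOn
  have hgb : ∀ w ∈ Metric.ball c ρ, ‖g w - f c‖ ≤ C * ρ ^ 2 := by
    intro w hw
    have h := norm_sub_sub_fderiv_le hd hM (Metric.ball_subset_ball hρR.le hw)
    have hw' : ‖w - c‖ ≤ ρ := by simpa [dist_eq_norm] using (Metric.mem_ball.1 hw).le
    rw [sub_right_comm] at h
    refine h.trans ?_
    calc 4 * M * (‖w - c‖ / R) ^ 2 ≤ 4 * M * (ρ / R) ^ 2 := by gcongr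
      _ = C * ρ ^ 2 := by rw [hC]; field_simp
  -- With `x` and `y` within `ρ / 4` of `c`, the ball of radius `ρ / 2` about `y` contains `x` and
  -- stays in the ball of radius `ρ` about `c`.
  have hnhds : Metric.ball c (ρ / 4) ×ˢ Metric.ball c (ρ / 4) ∈ 𝓝 (c, c) :=
    prod_mem_nhds (Metric.ball_mem_nhds _ (by positivity)) (Metric.ball_mem_nhds _ (by positivity))
  filter_upwards [hnhds] with q hq
  obtain ⟨x, y⟩ := q
  obtain ⟨hx, hy⟩ := hq
  simp only [Metric.mem_ball] at hx hy
  have hsub : Metric.ball y (ρ / 2) ⊆ Metric.ball c ρ :=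
    Metric.ball_subset_ball' (by linarith)
  have hxy : x ∈ Metric.ball y (ρ / 2) := by
    rw [Metric.mem_ball]; linarith [dist_triangle_right x y c]
  have := Complex.dist_le_div_mul_dist_of_mapsTo_ball (f := g) (c := y) (z := x) (R₁ := ρ / 2)
    (R₂ := 2 * (C * ρ ^ 2)) (hgd.mono (hsub.trans (Metric.ball_subset_ball hρR.le)))
    (fun w hw => ?_) hxy
  · rw [dist_eq_norm, dist_eq_norm] at this
    have e : g x - g y = f x - f y - fderiv ℂ f c (x - y) := by
      simp only [hg, map_sub]; abel
    rw [e] at this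
    refine this.trans ?_
    gcongr
    calc 2 * (C * ρ ^ 2) / (ρ / 2) = 4 * C * ρ := by field_simp; ring
      _ ≤ ε := hρε
  · rw [Metric.mem_closedBall, dist_eq_norm]
    have h1 := hgb w (hsub hw)
    have h2 := hgb y (hsub (Metric.mem_ball_self (by positivity)))
    have : g w - g y = (g w - f c) - (g y - f c) := by abel
    rw [this]
    linarith [norm_sub_le (g w - f c) (g y - f c)]

/-! ### Normal families along an ultrafilter -/

/-- Along the filter `l`, the maps `f k` are holomorphic and take values in `T` on a fixed
neighbourhood of each point of `S`. -/
def EventuallyHolomorphicInto {ι : Type*} (l : Filter ι) (f : ι → E → F) (S : Set E) (T : Set F) :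
    Prop :=
  ∀ z ∈ S, ∃ δ > 0, ∀ᶠ k in l, DifferentiableOn ℂ (f k) (Metric.ball z δ) ∧
    MapsTo (f k) (Metric.ball z δ) T

/-- Ultrafilter form of Montel's theorem. -/
theorem EventuallyHolomorphicInto.exists_limit [FiniteDimensional ℂ E] [FiniteDimensional ℂ F]
    {ι : Type*} {𝒰 : Ultrafilter ι} {f : ι → E → F} {S : Set E} {T : Set F} (hS : IsOpen S)
    (hT : Bornology.IsBounded T) (hf : EventuallyHolomorphicInto (𝒰 : Filter ι) f S T) :
    ∃ g : E → F, DifferentiableOn ℂ g S ∧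
      ∀ z ∈ S, Tendsto (fun q : ι × E => f q.1 q.2) ((𝒰 : Filter ι) ×ˢ 𝓝 z) (𝓝 (g z)) := by
  have : ProperSpace F := FiniteDimensional.proper ℂ F
  have : ProperSpace (E →L[ℂ] F) := FiniteDimensional.proper ℂ _
  obtain ⟨M, hM⟩ := hT.exists_norm_le
  have hlim : ∀ z, ∃ y, z ∈ S → Tendsto (fun k => f k z) 𝒰 (𝓝 y) := by
    intro z
    by_cases hz : z ∈ S
    · obtain ⟨δ, hδ, h⟩ := hf z hz
      obtain ⟨y, -, hy⟩ := (isCompact_closedBall (0 : F) M).ultrafilter_le_nhds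
        (𝒰.map fun k => f k z) (by
          refine le_principal_iff.2 (mem_map.2 (h.mono fun k hk => ?_))
          simpa using hM _ (hk.2 (Metric.mem_ball_self hδ)))
      exact ⟨y, fun _ => hy⟩
    · exact ⟨0, fun h => absurd h hz⟩
  choose g hg using hlim
  refine ⟨g, fun z hz => ?_, fun z hz => ?_⟩
  · obtain ⟨δ, hδ, h⟩ := hf z hz
    -- The derivatives at `z` are bounded by Cauchy's estimate, hence converge to some `A`. The
    -- second order Taylor bound passes to the limit and shows that `A` is the derivative of `g` at
    -- `z`.
    obtain ⟨A, -, hA⟩ := (isCompact_closedBall (0 : E →L[ℂ] F) (2 * M / δ)).ultrafilter_le_nhds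
        (𝒰.map fun k => fderiv ℂ (f k) z) (by
          refine le_principal_iff.2 (mem_map.2 (h.mono fun k hk => ?_))
          simpa using norm_fderiv_le_of_bounded_ball hδ hk.1 fun w hw => hM _ (hk.2 hw))
    replace hA : Tendsto (fun k => fderiv ℂ (f k) z) 𝒰 (𝓝 A) := hA
    refine (HasFDerivAt.of_isLittleO (f' := A) ?_).differentiableAt.differentiableWithinAt
    have hO : (fun w => g w - g z - A (w - z)) =O[𝓝 z] fun w => ‖w - z‖ ^ 2 := by
      refine Asymptotics.IsBigO.of_bound (4 * M / δ ^ 2) ?_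
      filter_upwards [hS.mem_nhds hz, Metric.ball_mem_nhds z hδ] with w hw hwδ
      have ht : Tendsto (fun k => ‖f k w - f k z - fderiv ℂ (f k) z (w - z)‖) 𝒰
          (𝓝 ‖g w - g z - A (w - z)‖) :=
        (((hg w hw).sub (hg z hz)).sub
          (((ContinuousLinearMap.apply ℂ F (w - z)).continuous.tendsto A).comp hA)).norm
      refine le_of_tendsto ht ?_
      filter_upwards [h] with k hk
      refine (norm_sub_sub_fderiv_le hk.1 (fun w hw => hM _ (hk.2 hw)) hwδ).trans (le_of_eq ?_)
      rw [norm_pow, norm_norm]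
      field_simp
    refine hO.trans_isLittleO ?_
    have := (Asymptotics.isLittleO_pow_id (𝕜 := ℝ) one_lt_two).comp_tendsto
      (tendsto_norm_sub_self z)
    exact Asymptotics.isLittleO_norm_right.1 this
  · obtain ⟨δ, hδ, h⟩ := hf z hz
    -- A Lipschitz bound uniform in `k` upgrades pointwise convergence to joint convergence.
    have h1 : Tendsto (fun q : ι × E => f q.1 q.2 - f q.1 z) ((𝒰 : Filter ι) ×ˢ 𝓝 z) (𝓝 0) := by
      have hb : Tendsto (fun q : ι × E => 2 * M / δ * ‖q.2 - z‖) ((𝒰 : Filter ι) ×ˢ 𝓝 z)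
          (𝓝 (2 * M / δ * 0)) :=
        ((tendsto_norm_sub_self z).comp tendsto_snd).const_mul _
      rw [mul_zero] at hb
      refine squeeze_zero_norm' ?_ hb
      filter_upwards [h.prod_mk (Metric.ball_mem_nhds z hδ)] with q hq
      exact norm_sub_le_of_bounded_ball hq.1.1 (fun w hw => hM _ (hq.1.2 hw)) hq.2
    have := h1.add ((hg z hz).comp tendsto_fst)
    simpa using this

theorem tendsto_apply_of_tendsto_prod {ι X Y : Type*} [TopologicalSpace X] {l : Filter ι}
    {f : ι → X → Y} {z : X} {m : Filter Y} {u : ι → X}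
    (h : Tendsto (fun q : ι × X => f q.1 q.2) (l ×ˢ 𝓝 z) m) (hu : Tendsto u l (𝓝 z)) :
    Tendsto (fun k => f k (u k)) l m :=
  h.comp (tendsto_id.prodMk hu)

theorem exists_ball_mapsTo_of_tendsto_prod {ι X Y : Type*} [PseudoMetricSpace X] {l : Filter ι} {f : ι → X → Y} {z : X}
    {m : Filter Y} {W : Set Y} (h : Tendsto (fun q : ι × X => f q.1 q.2) (l ×ˢ 𝓝 z) m)
    (hW : W ∈ m) : ∃ δ > 0, ∀ᶠ k in l, MapsTo (f k) (Metric.ball z δ) W := by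
  obtain ⟨p, hp, q, hq, hpq⟩ := eventually_prod_iff.1 (h hW)
  obtain ⟨δ, hδ, hball⟩ := Metric.eventually_nhds_iff_ball.1 hq
  exact ⟨δ, hδ, hp.mono fun k hk w hw => hpq hk (hball w hw)⟩

/-! ### Supporting functionals of convex and balanced domains -/

/-- A holomorphic map into the closure of an open convex set that meets the set stays in it. -/
theorem mapsTo_of_mapsTo_closure_of_convex {f : E → F} {D : Set E} {D' : Set F} {a : E}
    (hD : IsOpen D) (hDc : IsPreconnected D) (hD' : IsOpen D') (hconv : Convex ℝ D')
    (hf : DifferentiableOn ℂ f D) (hmaps : MapsTo f D (closure D')) (ha : a ∈ D)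
    (hfa : f a ∈ D') : MapsTo f D D' := by
  intro z hz
  by_contra hfz
  obtain ⟨l, hl⟩ := RCLike.geometric_hahn_banach_open_point (𝕜 := ℂ) hconv hD' hfz
  have hle : ∀ w ∈ closure D', (l w).re ≤ (l (f z)).re := fun w hw =>
    closure_minimal (fun w hw => (hl w hw).le)
      (isClosed_le (Complex.continuous_re.comp l.continuous) continuous_const) hw
  -- The modulus of `exp ∘ l ∘ f` is `exp (re (l ∘ f))`, so the maximum principle makes it constant,
  -- against the strict separation at `f a`.
  have hmax : IsMaxOn (norm ∘ fun w => Complex.exp (l (f w))) D z := fun w hw => by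
    simpa [Complex.norm_exp] using hle _ (hmaps hw)
  have := Complex.norm_eqOn_of_isPreconnected_of_isMaxOn hDc hD
    ((l.differentiable.comp_differentiableOn hf).cexp) hz hmax ha
  simp only [Function.comp_apply, Complex.norm_exp, Function.const_apply, Real.exp_eq_exp] at this
  exact (hl _ hfa).ne this

theorem exists_continuousLinearMap_norm_lt_one {D : Set E} {q : E} (hD : IsOpen D)
    (hconv : Convex ℝ D) (hbal : Balanced ℂ D) (h0 : (0 : E) ∈ D) (hq : q ∉ D) :
    ∃ l : E →L[ℂ] ℂ, l q = 1 ∧ ∀ w ∈ D, ‖l w‖ < 1 := by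
  obtain ⟨l, hl⟩ := RCLike.geometric_hahn_banach_open_point (𝕜 := ℂ) hconv hD hq
  replace hl : ∀ w ∈ D, (l w).re < (l q).re := hl
  have hpos : 0 < (l q).re := by simpa using hl 0 h0
  have hne : l q ≠ 0 := fun h => by simp [h] at hpos
  refine ⟨(l q)⁻¹ • l, by simp [hne], fun w hw => ?_⟩
  have key : ‖l w‖ < ‖l q‖ := by
    refine lt_of_lt_of_le ?_ (Complex.re_le_norm _)
    by_cases hw0 : l w = 0
    · simpa [hw0] using hpos
    · have hn : ‖l w‖ ≠ 0 := norm_ne_zero_iff.2 hw0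
      -- Balancedness allows rotating `w` until `l w` becomes its own modulus.
      have h := hl ((‖l w‖ / l w) • w) (hbal.smul_mem (by simp [hn]) hw)
      rw [map_smul, smul_eq_mul, div_mul_cancel₀ _ hw0] at h
      simpa using h
  rw [smul_apply, smul_eq_mul, norm_mul, norm_inv, inv_mul_lt_one₀
    (norm_pos_iff.2 hne)]
  exact key

/-- The derivative at the origin of a holomorphic map between balanced domains that fixes the
origin maps the first domain into the second one, if the latter is convex. -/
theorem mapsTo_fderiv_zero_of_balanced {f : E → F} {D : Set E} {D' : Set F} (hD : IsOpen D)
    (hbal : Balanced ℂ D) (hD' : IsOpen D') (hconv : Convex ℝ D') (hbal' : Balanced ℂ D')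
    (hf : DifferentiableOn ℂ f D) (hmaps : MapsTo f D D') (h0 : f 0 = 0) :
    MapsTo (fderiv ℂ f 0) D D' := by
  intro z hz
  by_contra hLz
  have h0D : (0 : E) ∈ D := hbal.zero_mem ⟨z, hz⟩
  obtain ⟨l, hl1, hl⟩ := exists_continuousLinearMap_norm_lt_one hD' hconv hbal'
    (h0 ▸ hmaps h0D) hLz
  -- Openness gives room for a disc of radius `R > 1` in the direction `z`. On it `l ∘ f` has
  -- modulus at most `1`, so its derivative at the centre is at most `1 / R`, whereas the choice of
  -- `l` makes it `1`.
  obtain ⟨R, hR1, hRz⟩ : ∃ R : ℝ, 1 < R ∧ (R : ℂ) • z ∈ D := by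
    have hc : Tendsto (fun R : ℝ => (R : ℂ) • z) (𝓝[>] 1) (𝓝 z) := by
      have : Continuous fun R : ℝ => (R : ℂ) • z := by fun_prop
      simpa using (this.tendsto 1).mono_left nhdsWithin_le_nhds
    obtain ⟨R, h1, h2⟩ := ((hc.eventually (hD.mem_nhds hz)).and self_mem_nhdsWithin).exists
    exact ⟨R, h2, h1⟩
  have hR0 : (0 : ℝ) < R := by linarith
  have hin : ∀ ζ ∈ Metric.ball (0 : ℂ) R, ζ • z ∈ D := by
    intro ζ hζ
    have : ζ • z = (ζ / R) • (R : ℂ) • z := by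
      rw [smul_smul, div_mul_cancel₀ _ (by exact_mod_cast hR0.ne')]
    rw [this]
    refine hbal.smul_mem ?_ hRz
    rw [norm_div, Complex.norm_real, Real.norm_of_nonneg hR0.le, div_le_one hR0]
    exact (mem_ball_zero_iff.1 hζ).le
  have hg : DifferentiableOn ℂ (fun ζ : ℂ => l (f (ζ • z))) (Metric.ball 0 R) :=
    l.differentiable.comp_differentiableOn
      (hf.comp (differentiable_id.smul_const z).differentiableOn hin)
  have hderiv : HasDerivAt (fun ζ : ℂ => l (f (ζ • z))) 1 0 := by
    have h1 : HasFDerivAt f (fderiv ℂ f 0) ((0 : ℂ) • z) := by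
      rw [zero_smul]
      exact (hf.differentiableAt (hD.mem_nhds h0D)).hasFDerivAt
    have h2 : HasDerivAt (fun ζ : ℂ => ζ • z) ((1 : ℂ) • z) 0 := (hasDerivAt_id 0).smul_const z
    have := l.hasFDerivAt.comp_hasDerivAt 0 (h1.comp_hasDerivAt 0 h2)
    simpa [Function.comp_def, hl1] using this
  have := Complex.norm_deriv_le_div_of_mapsTo_ball (R₂ := 1) hg (fun ζ hζ => by
    simpa [h0] using (hl _ (hmaps (hin ζ hζ))).le) hR0
  rw [hderiv.deriv, norm_one, le_div_iff₀ hR0] at this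
  linarith

/-- Since `φ k` eventually pushes a small ball into `W`, a map `f` defined only near `p` can be
inserted between globally defined ones. It serves both for the rescaled maps and for their inverses.
-/
theorem EventuallyHolomorphicInto.comp_comp {ι : Type*} {l : Filter ι} {φ : ι → E → E}
    {ψ : ι → F → F} {f : E → F} {D W : Set E} {D' : Set F} {p : E}
    (hφ : EventuallyHolomorphicInto l φ D D)
    (hlim : ∀ z ∈ D, Tendsto (fun q : ι × E => φ q.1 q.2) (l ×ˢ 𝓝 z) (𝓝 p))
    (hW : W ∈ 𝓝 p) (hf : DifferentiableOn ℂ f (W ∩ D)) (hfm : MapsTo f (W ∩ D) D')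
    (hψ : ∀ k, DifferentiableOn ℂ (ψ k) D' ∧ MapsTo (ψ k) D' D') :
    EventuallyHolomorphicInto l (fun k z => ψ k (f (φ k z))) D D' := by
  intro z hz
  obtain ⟨δ₁, hδ₁, h₁⟩ := hφ z hz
  obtain ⟨δ₂, hδ₂, h₂⟩ := exists_ball_mapsTo_of_tendsto_prod (hlim z hz) hW
  refine ⟨min δ₁ δ₂, by positivity, ?_⟩
  filter_upwards [h₁, h₂] with k hk₁ hk₂
  have hb₁ : Metric.ball z (min δ₁ δ₂) ⊆ Metric.ball z δ₁ :=
    Metric.ball_subset_ball (min_le_left _ _)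
  have hm : MapsTo (φ k) (Metric.ball z (min δ₁ δ₂)) (W ∩ D) := fun y hy =>
    ⟨hk₂ (Metric.ball_subset_ball (min_le_right _ _) hy), hk₁.2 (hb₁ hy)⟩
  exact ⟨(hψ k).1.comp (hf.comp (hk₁.1.mono hb₁) hm) (hfm.comp hm), (hψ k).2.comp (hfm.comp hm)⟩

end NormedSpaces

section FiniteDimensionalSpaces

variable {E F : Type*} [NormedAddCommGroup E] [NormedSpace ℂ E] [FiniteDimensional ℂ E]
  [NormedAddCommGroup F] [NormedSpace ℂ F] [FiniteDimensional ℂ F]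

/-! ### Convergence of automorphisms to a local peak point -/

/-- `h` is a peak function at `p` for the trace of `D` on the neighbourhood `W` of `p`. -/
structure IsLocalPeakFunction (D : Set E) (p : E) (W : Set E) (h : E → ℂ) : Prop where
  isOpen : IsOpen W
  mem : p ∈ W
  differentiableOn : DifferentiableOn ℂ h (D ∩ W)
  continuousOn : ContinuousOn h (closure D ∩ W)
  apply_self : h p = 1
  norm_lt_one : ∀ z ∈ closure D ∩ W, z ≠ p → ‖h z‖ < 1

/-- If an orbit of a sequence of holomorphic self-maps tends to a local peak point, then the
sequence tends to that point locally uniformly. -/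
theorem IsLocalPeakFunction.tendsto_prod {ι : Type*} {𝒰 : Ultrafilter ι} {φ : ι → E → E}
    {D W : Set E} {p a : E} {h : E → ℂ} (hh : IsLocalPeakFunction D p W h) (hD : IsOpen D)
    (hDc : IsPreconnected D) (hDb : Bornology.IsBounded D)
    (hφ : EventuallyHolomorphicInto (𝒰 : Filter ι) φ D D) (ha : a ∈ D)
    (hlim : Tendsto (fun k => φ k a) 𝒰 (𝓝 p)) {z : E} (hz : z ∈ D) :
    Tendsto (fun q : ι × E => φ q.1 q.2) ((𝒰 : Filter ι) ×ˢ 𝓝 z) (𝓝 p) := by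
  obtain ⟨g, hgd, hg⟩ := hφ.exists_limit hD hDb
  have hgpt : ∀ w ∈ D, Tendsto (fun k => φ k w) 𝒰 (𝓝 (g w)) := fun w hw =>
    tendsto_apply_of_tendsto_prod (hg w hw) tendsto_const_nhds
  have hmem : ∀ w ∈ D, ∀ᶠ k in (𝒰 : Filter ι), φ k w ∈ D := fun w hw => by
    obtain ⟨δ, hδ, hk⟩ := hφ w hw
    exact hk.mono fun k hk => hk.2 (Metric.mem_ball_self hδ)
  have hgcl : ∀ w ∈ D, g w ∈ closure D := fun w hw =>
    mem_closure_of_tendsto (hgpt w hw) (hmem w hw)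
  -- Where `g` hits `p`, the function `h ∘ g` attains its maximal modulus `1`. So it has modulus `1`
  -- nearby, which only the value `p` of `g` allows.
  have hopen : IsOpen (D ∩ g ⁻¹' {p}) := by
    refine isOpen_iff_mem_nhds.2 fun w hw => ?_
    obtain ⟨hwD, hwp⟩ := hw
    replace hwp : g w = p := hwp
    obtain ⟨η, hη, hηW⟩ := Metric.nhds_basis_closedBall.mem_iff.1 (hh.isOpen.mem_nhds hh.mem)
    obtain ⟨δ₁, hδ₁, h₁⟩ := exists_ball_mapsTo_of_tendsto_prod (hwp ▸ hg w hwD)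
      (Metric.closedBall_mem_nhds p hη)
    obtain ⟨δ₂, hδ₂, h₂⟩ := hφ w hwD
    obtain ⟨δ₃, hδ₃, h₃⟩ := Metric.isOpen_iff.1 hD w hwD
    set δ := min δ₁ (min δ₂ δ₃) with hδdef
    have hδ : 0 < δ := by positivity
    have hb₁ : Metric.ball w δ ⊆ Metric.ball w δ₁ := Metric.ball_subset_ball (min_le_left _ _)
    have hb₂ : Metric.ball w δ ⊆ Metric.ball w δ₂ :=
      Metric.ball_subset_ball ((min_le_right _ _).trans (min_le_left _ _))
    have hb₃ : Metric.ball w δ ⊆ D :=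
      (Metric.ball_subset_ball ((min_le_right _ _).trans (min_le_right _ _))).trans h₃
    have hnorm : ∀ x ∈ closure D ∩ W, ‖h x‖ ≤ 1 := fun x hx => by
      by_cases hxp : x = p
      · rw [hxp, hh.apply_self, norm_one]
      · exact (hh.norm_lt_one x hx hxp).le
    have hcomp : EventuallyHolomorphicInto (𝒰 : Filter ι) (fun k x => h (φ k x))
        (Metric.ball w δ) (Metric.closedBall 0 1) := by
      intro x hx
      obtain ⟨r, hr, hrb⟩ := Metric.isOpen_iff.1 Metric.isOpen_ball x hx
      refine ⟨r, hr, ?_⟩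
      filter_upwards [h₁, h₂] with k hk₁ hk₂
      have hm : MapsTo (φ k) (Metric.ball x r) (D ∩ W) := fun y hy =>
        ⟨hk₂.2 (hb₂ (hrb hy)), hηW (hk₁ (hb₁ (hrb hy)))⟩
      refine ⟨hh.differentiableOn.comp (hk₂.1.mono (hrb.trans hb₂)) hm, fun y hy => ?_⟩
      rw [mem_closedBall_zero_iff]
      exact hnorm _ ⟨subset_closure (hm hy).1, (hm hy).2⟩
    -- The values of `g` may lie on the boundary, where `h` is merely continuous. Holomorphy of `h ∘
    -- g` is therefore obtained by exhibiting it as the limit `G` of the `h ∘ φ k`.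
    obtain ⟨G, hGd, hG⟩ := hcomp.exists_limit Metric.isOpen_ball Metric.isBounded_closedBall
    have hgW : ∀ x ∈ Metric.ball w δ, g x ∈ closure D ∩ W := fun x hx =>
      ⟨hgcl x (hb₃ hx), hηW (Metric.isClosed_closedBall.mem_of_tendsto (hgpt x (hb₃ hx))
        (h₁.mono fun k hk => hk (hb₁ hx)))⟩
    have hGeq : ∀ x ∈ Metric.ball w δ, G x = h (g x) := by
      intro x hx
      refine tendsto_nhds_unique
        (tendsto_apply_of_tendsto_prod (f := fun k x => h (φ k x)) (hG x hx) tendsto_const_nhds) ?_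
      refine (hh.continuousOn (g x) (hgW x hx)).tendsto.comp
        (tendsto_nhdsWithin_iff.2 ⟨hgpt x (hb₃ hx), ?_⟩)
      filter_upwards [h₁, h₂] with k hk₁ hk₂
      exact ⟨subset_closure (hk₂.2 (hb₂ hx)), hηW (hk₁ (hb₁ hx))⟩
    have hwδ : w ∈ Metric.ball w δ := Metric.mem_ball_self hδ
    have hmax : IsMaxOn (norm ∘ G) (Metric.ball w δ) w := fun x hx => by
      simp only [mem_ofPred_eq, Function.comp_apply, hGeq x hx, hGeq w hwδ, hwp, hh.apply_self,
        norm_one]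
      exact hnorm _ (hgW x hx)
    have hconst := Complex.norm_eqOn_of_isPreconnected_of_isMaxOn
      (convex_ball w δ).isPreconnected Metric.isOpen_ball hGd hwδ hmax
    filter_upwards [Metric.ball_mem_nhds w hδ] with x hx
    refine ⟨hb₃ hx, ?_⟩
    by_contra hxp
    have h1 := hconst hx
    simp only [Function.comp_apply, Function.const_apply, hGeq x hx, hGeq w hwδ, hwp,
      hh.apply_self, norm_one] at h1
    exact (hh.norm_lt_one _ (hgW x hx) hxp).ne h1
  -- The fibre over `p` is open and closed in `D` and contains `a`.
  have hsub : D ⊆ D ∩ g ⁻¹' {p} := by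
    refine hDc.subset_of_closure_inter_subset hopen
      ⟨a, ha, ha, tendsto_nhds_unique (hgpt a ha) hlim⟩ ?_
    rintro x ⟨hxcl, hxD⟩
    refine ⟨hxD, ?_⟩
    have hc := (hgd.continuousOn.continuousAt (hD.mem_nhds hxD))
    simpa using hc.continuousWithinAt.mem_closure (t := {p}) hxcl fun y hy => hy.2
  have := hg z hz
  rwa [show g z = p from (hsub hz).2] at this

/-! ### Biholomorphic limits and involutions -/

/-- The limit of mutually inverse, asymptotically globally defined holomorphic maps between bounded
convex domains is biholomorphic as soon as it does not degenerate at one point. -/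
theorem exists_biholomorphic_limit {ι : Type*} {𝒰 : Ultrafilter ι} {f : ι → E → F}
    {g : ι → F → E} {D : Set E} {D' : Set F} {a : E} {b : F} (hD : IsOpen D) (hDc : Convex ℝ D)
    (hDb : Bornology.IsBounded D) (hD' : IsOpen D') (hDc' : Convex ℝ D')
    (hDb' : Bornology.IsBounded D') (hf : EventuallyHolomorphicInto (𝒰 : Filter ι) f D D')
    (hg : EventuallyHolomorphicInto (𝒰 : Filter ι) g D' D)
    (hgf : ∀ z ∈ D, ∀ᶠ k in (𝒰 : Filter ι), g k (f k z) = z)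
    (hfg : ∀ w ∈ D', ∀ᶠ k in (𝒰 : Filter ι), f k (g k w) = w)
    (ha : a ∈ D) (hb : b ∈ D') (hab : Tendsto (fun k => f k a) 𝒰 (𝓝 b)) :
    ∃ (f₀ : E → F) (g₀ : F → E), DifferentiableOn ℂ f₀ D ∧ DifferentiableOn ℂ g₀ D' ∧
      MapsTo f₀ D D' ∧ MapsTo g₀ D' D ∧ InvOn g₀ f₀ D D' ∧
      ∀ z ∈ D, Tendsto (fun k => f k z) 𝒰 (𝓝 (f₀ z)) := by
  obtain ⟨f₀, hf₀d, hf₀⟩ := hf.exists_limit hD hDb'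
  obtain ⟨g₀, hg₀d, hg₀⟩ := hg.exists_limit hD' hDb
  have hfpt : ∀ z ∈ D, Tendsto (fun k => f k z) 𝒰 (𝓝 (f₀ z)) := fun z hz =>
    tendsto_apply_of_tendsto_prod (hf₀ z hz) tendsto_const_nhds
  have hgpt : ∀ z ∈ D', Tendsto (fun k => g k z) 𝒰 (𝓝 (g₀ z)) := fun z hz =>
    tendsto_apply_of_tendsto_prod (hg₀ z hz) tendsto_const_nhds
  have hfcl : MapsTo f₀ D (closure D') := fun z hz => by
    obtain ⟨δ, hδ, hk⟩ := hf z hz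
    exact mem_closure_of_tendsto (hfpt z hz) (hk.mono fun k hk => hk.2 (Metric.mem_ball_self hδ))
  have hgcl : MapsTo g₀ D' (closure D) := fun z hz => by
    obtain ⟨δ, hδ, hk⟩ := hg z hz
    exact mem_closure_of_tendsto (hgpt z hz) (hk.mono fun k hk => hk.2 (Metric.mem_ball_self hδ))
  have hfa : f₀ a = b := tendsto_nhds_unique (hfpt a ha) hab
  have hfm : MapsTo f₀ D D' := mapsTo_of_mapsTo_closure_of_convex hD hDc.isPreconnected hD' hDc'
    hf₀d hfcl ha (hfa ▸ hb)
  have hleft : LeftInvOn g₀ f₀ D := fun z hz =>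
    tendsto_nhds_unique (tendsto_apply_of_tendsto_prod (hg₀ _ (hfm hz)) (hfpt z hz))
      (tendsto_const_nhds.congr' ((hgf z hz).mono fun k hk => hk.symm))
  -- Nondegeneracy of `g₀` comes for free: `g₀ b = g₀ (f₀ a) = a`.
  have hgm : MapsTo g₀ D' D := mapsTo_of_mapsTo_closure_of_convex hD' hDc'.isPreconnected hD hDc
    hg₀d hgcl hb (by rw [← hfa, hleft ha]; exact ha)
  have hright : RightInvOn g₀ f₀ D' := fun z hz =>
    tendsto_nhds_unique (tendsto_apply_of_tendsto_prod (hf₀ _ (hgm hz)) (hgpt z hz))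
      (tendsto_const_nhds.congr' ((hfg z hz).mono fun k hk => hk.symm))
  exact ⟨f₀, g₀, hf₀d, hg₀d, hfm, hgm, ⟨hleft, hright⟩, hfpt⟩

/-- A holomorphic involution has derivative `-1` at an isolated fixed point. -/
theorem fderiv_eq_neg_one_of_involution {s : E → E} {D : Set E} {a : E} (hD : IsOpen D)
    (hDb : Bornology.IsBounded D) (ha : a ∈ D) (hs : DifferentiableOn ℂ s D) (hsm : MapsTo s D D)
    (hinv : ∀ z ∈ D, s (s z) = z) (hsa : s a = a) (hiso : ∀ᶠ z in 𝓝[≠] a, s z ≠ z) (v : E) :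
    fderiv ℂ s a v = -v := by
  have : CompleteSpace E := FiniteDimensional.complete ℂ E
  obtain ⟨R, hR, hRD⟩ := Metric.isOpen_iff.1 hD a ha
  obtain ⟨M, hM⟩ := hDb.exists_norm_le
  set A := fderiv ℂ s a with hA
  have hsA : HasStrictFDerivAt s A a := hasStrictFDerivAt_of_differentiableOn_of_bounded hR
    (hs.mono hRD) fun w hw => hM _ (hsm (hRD hw))
  have hAA : ∀ u, A (A u) = u := by
    have h1 : HasFDerivAt (fun z => s (s z)) (A.comp A) a :=
      HasFDerivAt.comp a (hsa.symm ▸ hsA.hasFDerivAt) hsA.hasFDerivAt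
    have h2 : HasFDerivAt (fun z => s (s z)) (ContinuousLinearMap.id ℂ E) a :=
      (hasFDerivAt_id a).congr_of_eventuallyEq (by
        filter_upwards [hD.mem_nhds ha] with z hz using hinv z hz)
    intro u
    exact DFunLike.congr_fun (h1.unique h2) u
  by_contra hne
  -- As `A ∘ A = 1`, a failure of `A v = -v` makes `u` a nonzero vector fixed by `A`.
  set u := A v + v with hu
  have hu0 : u ≠ 0 := fun h => hne (eq_neg_of_add_eq_zero_left h)
  have hAu : A u = u := by rw [hu, map_add, hAA, add_comm]
  -- Averaging over the group generated by the involution gives a coordinate with derivative `1` at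
  -- `a` in which `s` acts as the linear map `A`. The complex line through `u` then corresponds to
  -- fixed points of `s` accumulating at `a`.
  set ϕ : E → E := fun z => (2⁻¹ : ℂ) • ((z - a) + A (s z - a)) with hϕ
  have hϕ' : HasStrictFDerivAt ϕ
      ((ContinuousLinearEquiv.refl ℂ E : E ≃L[ℂ] E) : E →L[ℂ] E) a := by
    have h := (((hasStrictFDerivAt_id a).sub_const a).add
      (A.hasStrictFDerivAt.comp a (hsA.sub_const a))).const_smul (2⁻¹ : ℂ)
    refine h.congr_fderiv ?_
    ext w
    simp only [smul_apply, add_apply, ContinuousLinearMap.coe_comp, Function.comp_apply, hAA,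
      ContinuousLinearMap.coe_id', id, ContinuousLinearEquiv.coe_coe,
      ContinuousLinearEquiv.refl_apply]
    module
  have hϕa : ϕ a = 0 := by simp [hϕ, hsa]
  have hϕs : ∀ z ∈ D, ϕ (s z) = A (ϕ z) := fun z hz => by
    simp only [hϕ, map_smul, map_add, hAA, hinv z hz]
    rw [add_comm]
  set e := hϕ'.toOpenPartialHomeomorph ϕ with he
  have hasrc : a ∈ e.source := hϕ'.mem_toOpenPartialHomeomorph_source
  have hea : e a = 0 := hϕa
  have h0tgt : (0 : E) ∈ e.target := hea ▸ e.map_source hasrc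
  have hsymm : e.symm 0 = a := by rw [← hea, e.left_inv hasrc]
  have hcurve : Tendsto (fun t : ℂ => t • u) (𝓝[≠] 0) (𝓝 0) := by
    have : Continuous fun t : ℂ => t • u := by fun_prop
    simpa using (this.tendsto 0).mono_left nhdsWithin_le_nhds
  have hz : Tendsto (fun t : ℂ => e.symm (t • u)) (𝓝[≠] 0) (𝓝 a) := by
    have := (e.continuousAt_symm h0tgt).tendsto.comp hcurve
    rwa [hsymm] at this
  have hsz : Tendsto (fun t : ℂ => s (e.symm (t • u))) (𝓝[≠] 0) (𝓝 a) := by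
    have := hsA.continuousAt.tendsto.comp hz
    rwa [hsa] at this
  have hval : ∀ᶠ t : ℂ in 𝓝[≠] 0, ϕ (e.symm (t • u)) = t • u := by
    filter_upwards [hcurve.eventually (e.open_target.mem_nhds h0tgt)] with t ht
    exact e.right_inv ht
  have hz' : Tendsto (fun t : ℂ => e.symm (t • u)) (𝓝[≠] 0) (𝓝[≠] a) := by
    refine tendsto_nhdsWithin_iff.2 ⟨hz, ?_⟩
    filter_upwards [hval, self_mem_nhdsWithin] with t ht ht0 hta
    rw [hta, hϕa] at ht
    exact smul_ne_zero ht0 hu0 ht.symm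
  have hfix : ∀ᶠ t : ℂ in 𝓝[≠] 0, s (e.symm (t • u)) = e.symm (t • u) := by
    filter_upwards [hval, hz.eventually (hD.mem_nhds ha),
      hz.eventually (e.open_source.mem_nhds hasrc),
      hsz.eventually (e.open_source.mem_nhds hasrc)] with t ht htD ht1 ht2
    refine e.injOn ht2 ht1 ?_
    change ϕ _ = ϕ _
    rw [hϕs _ htD, ht, map_smul, hAu]
  obtain ⟨t, ht1, ht2⟩ := ((hz'.eventually hiso).and hfix).exists
  exact ht1 ht2

end FiniteDimensionalSpaces

section Biholomorphisms

variable {n : ℕ}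

local notation "𝔼" => EuclideanSpace ℂ (Fin n)

/-! ### Basic properties of biholomorphisms -/

theorem IsBiholomorphism.comp {f g : 𝔼 → 𝔼} {U V W : Set 𝔼} (hg : IsBiholomorphism g V W)
    (hf : IsBiholomorphism f U V) : IsBiholomorphism (g ∘ f) U W := by
  obtain ⟨hU, hV, hfd, hfm, f', hf'd, hf'm, hf'⟩ := hf
  obtain ⟨-, hW, hgd, hgm, g', hg'd, hg'm, hg'⟩ := hg
  exact ⟨hU, hW, hgd.comp hfd hfm, hgm.comp hfm, f' ∘ g', hf'd.comp hg'd hg'm, hf'm.comp hg'm,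
    hf'.comp hg' hfm hg'm⟩

theorem IsBiholomorphism.exists_inverse {f : 𝔼 → 𝔼} {U V : Set 𝔼} (hf : IsBiholomorphism f U V) :
    ∃ g, IsBiholomorphism g V U ∧ InvOn g f U V := by
  obtain ⟨hU, hV, hfd, hfm, g, hgd, hgm, hg⟩ := hf
  exact ⟨g, ⟨hV, hU, hgd, hgm, f, hfd, hfm, hg.symm⟩, hg⟩

theorem isBiholomorphism_id {U : Set 𝔼} (hU : IsOpen U) : IsBiholomorphism id U U :=
  ⟨hU, hU, differentiableOn_id, mapsTo_id U, id, differentiableOn_id, mapsTo_id U,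
    invOn_id U⟩

theorem IsBiholomorphism.eventuallyHolomorphicInto {ι : Type*} {l : Filter ι} {φ : ι → 𝔼 → 𝔼}
    {D : Set 𝔼} (hD : IsOpen D) (hφ : ∀ k, IsBiholomorphism (φ k) D D) :
    EventuallyHolomorphicInto l φ D D := by
  intro z hz
  obtain ⟨δ, hδ, hb⟩ := Metric.isOpen_iff.1 hD z hz
  exact ⟨δ, hδ, Eventually.of_forall fun k =>
    ⟨(hφ k).2.2.1.mono hb, (hφ k).2.2.2.1.mono_left hb⟩⟩

/-! ### Homogeneity of convex balanced symmetric domains -/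

/-- Translation of the unit disc along its real diameter. -/
theorem norm_moebius_lt_one {b : ℝ} (hb0 : 0 ≤ b) (hb1 : b < 1) {ζ : ℂ} (hζ : ‖ζ‖ < 1) :
    1 + b * ζ ≠ 0 ∧ ‖(ζ + b) / (1 + b * ζ)‖ < 1 := by
  have hne : 1 + b * ζ ≠ 0 := by
    intro h
    have h1 : ‖(b : ℂ) * ζ‖ = 1 := by rw [← norm_neg, ← eq_neg_of_add_eq_zero_left h, norm_one]
    rw [norm_mul, Complex.norm_real, Real.norm_of_nonneg hb0] at h1
    nlinarith [norm_nonneg ζ]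
  refine ⟨hne, ?_⟩
  rw [norm_div, div_lt_one (norm_pos_iff.2 hne)]
  refine lt_of_pow_lt_pow_left₀ 2 (norm_nonneg _) ?_
  have h2 : ‖ζ‖ ^ 2 < 1 := by nlinarith [norm_nonneg ζ]
  rw [← Complex.normSq_eq_norm_sq, Complex.normSq_apply] at h2 ⊢
  rw [← Complex.normSq_eq_norm_sq, Complex.normSq_apply]
  simp only [Complex.add_re, Complex.add_im, Complex.ofReal_re, Complex.ofReal_im, Complex.mul_re,
    Complex.mul_im, Complex.one_re, Complex.one_im]
  -- The identity behind this is `|1 + bζ|² - |ζ + b|² = (1 - |ζ|²)(1 - b²)`.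
  nlinarith [mul_pos (sub_pos.2 h2) (show 0 < 1 - b ^ 2 by nlinarith)]

/-- A quantitative Schwarz–Pick inequality: a holomorphic self-map of the closed unit disc that is
small at `b` cannot attain modulus `r` at `r`, unless `b` is small. -/
theorem le_of_mapsTo_unit_ball {f : ℂ → ℂ} {b r δ : ℝ} (hb0 : 0 ≤ b) (hbr : b ≤ r) (hr : r < 1)
    (hf : DifferentiableOn ℂ f (Metric.ball 0 1))
    (hm : MapsTo f (Metric.ball 0 1) (Metric.closedBall 0 1)) (hfb : ‖f b‖ ≤ δ) (hfr : r ≤ ‖f r‖) :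
    b * (1 - r ^ 2) ≤ 2 * δ := by
  have hb1 : b < 1 := hbr.trans_lt hr
  have hpos : 0 < 1 - b * r := by nlinarith
  set m : ℂ → ℂ := fun ζ => (ζ + b) / (1 + b * ζ) with hmdef
  have hmm : MapsTo m (Metric.ball 0 1) (Metric.ball 0 1) := fun ζ hζ =>
    mem_ball_zero_iff.2 (norm_moebius_lt_one hb0 hb1 (mem_ball_zero_iff.1 hζ)).2
  have hmd : DifferentiableOn ℂ m (Metric.ball 0 1) := by
    refine DifferentiableOn.div (by fun_prop) (by fun_prop) fun ζ hζ =>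
      (norm_moebius_lt_one hb0 hb1 (mem_ball_zero_iff.1 hζ)).1
  -- This is the preimage of `r` under `m`, while `m 0 = b`. The Schwarz lemma for `f ∘ m` gives `r
  -- ≤ (1 + δ) * τ + δ ≤ τ + 2 * δ`, to be compared with `τ ≤ r - b * (1 - r ^ 2)`.
  set τ : ℝ := (r - b) / (1 - b * r) with hτ
  have hτ0 : 0 ≤ τ := div_nonneg (by linarith) hpos.le
  have hτ1 : τ < 1 := by rw [hτ, div_lt_one hpos]; nlinarith
  have hτb : τ ≤ r - b * (1 - r ^ 2) := by
    rw [hτ, div_le_iff₀ hpos]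
    have h : 0 ≤ b * r * (b * (1 - r ^ 2)) := by
      have : 0 ≤ 1 - r ^ 2 := by nlinarith
      have : 0 ≤ r := hb0.trans hbr
      positivity
    nlinarith
  have hmτ : m τ = r := by
    have h1 : (1 - b * r : ℂ) ≠ 0 := by exact_mod_cast hpos.ne'
    have h1' : (1 - r * b : ℂ) ≠ 0 := by rwa [mul_comm]
    have h2 : (1 - b ^ 2 : ℂ) ≠ 0 := by
      have : (1 - b ^ 2 : ℝ) ≠ 0 := by nlinarith
      exact_mod_cast this
    have h3 : (1 + b * τ : ℂ) = (1 - b ^ 2) / (1 - b * r) := by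
      rw [hτ]; push_cast; field_simp; ring
    have h4 : (τ + b : ℂ) = r * (1 - b ^ 2) / (1 - b * r) := by
      rw [hτ]; push_cast; field_simp; ring
    simp only [hmdef, h3, h4]
    field_simp
  have hm0 : m 0 = b := by simp [hmdef]
  have hδ : 0 ≤ δ := (norm_nonneg _).trans hfb
  have key := Complex.dist_le_div_mul_dist_of_mapsTo_ball (f := f ∘ m) (c := 0) (z := (τ : ℂ))
    (R₁ := 1) (R₂ := 1 + δ) (hf.comp hmd hmm) (fun ζ hζ => by
      rw [Metric.mem_closedBall, dist_eq_norm]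
      have h1 := mem_closedBall_zero_iff.1 (hm (hmm hζ))
      have h2 := norm_sub_le (f (m ζ)) (f (m 0))
      rw [hm0] at h2
      simp only [Function.comp_apply, hm0]
      linarith) (by simpa [abs_of_nonneg hτ0] using hτ1)
  simp only [Function.comp_apply, hmτ, hm0, dist_eq_norm, sub_zero, Complex.norm_real,
    Real.norm_of_nonneg hτ0, div_one] at key
  have h5 : ‖f r‖ ≤ ‖f r - f b‖ + ‖f b‖ := by simpa using norm_add_le (f r - f b) (f b)
  nlinarith

theorem IsBoundedConvexBalancedDomain.zero_mem {D : Set 𝔼} (hD : IsBoundedConvexBalancedDomain D) :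
    (0 : 𝔼) ∈ D :=
  hD.balanced.zero_mem hD.isDomainIn.isConnected.nonempty

/-- In a symmetric convex balanced domain, every nonzero point can be moved closer to the origin by
a symmetry. -/
theorem exists_automorphism_gauge_lt {D : Set 𝔼} (hD : IsBoundedConvexBalancedDomain D)
    (hs : IsBoundedSymmetricDomain D) {y : 𝔼} (hy : y ∈ D) (hy0 : y ≠ 0) :
    ∃ s : 𝔼 → 𝔼, IsBiholomorphism s D D ∧ gauge D (s y) < gauge D y := by
  have hDo : IsOpen D := hD.isDomainIn.isOpen
  have h0 : (0 : 𝔼) ∈ D := hD.zero_mem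
  have habs : Absorbent ℝ D := absorbent_nhds_zero (hDo.mem_nhds h0)
  obtain ⟨M, hM⟩ := hD.isBounded.exists_norm_le
  obtain ⟨δ, hδ, hδD⟩ : ∃ δ > 0, Metric.ball (0 : 𝔼) (2 * δ) ⊆ D := by
    obtain ⟨δ, hδ, h⟩ := Metric.isOpen_iff.1 hDo 0 h0
    exact ⟨δ / 2, by positivity, by rwa [mul_div_cancel₀ _ two_ne_zero]⟩
  set r := gauge D y with hr
  have hr0 : 0 < r := (gauge_pos habs
    ((NormedSpace.isVonNBounded_iff ℝ).2 hD.isBounded)).2 hy0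
  have hr1 : r < 1 := gauge_lt_one_of_mem_of_isOpen hDo hy
  set C := 1 / δ * (4 * M * (‖y‖ / δ) ^ 2) with hC
  obtain ⟨ε, hε0, hε1, hε2, hε3⟩ :
      ∃ ε : ℝ, 0 < ε ∧ 2 * ε < 1 ∧ ε * ‖y‖ < δ ∧ C * ε < r * (1 - r ^ 2) := by
    have e1 : ∀ᶠ ε : ℝ in 𝓝[>] 0, 2 * ε < 1 := nhdsWithin_le_nhds
      ((continuous_const.mul continuous_id).continuousAt.eventually_lt continuousAt_const
        (by simp))
    have e2 : ∀ᶠ ε : ℝ in 𝓝[>] 0, ε * ‖y‖ < δ := nhdsWithin_le_nhds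
      ((continuous_id.mul continuous_const).continuousAt.eventually_lt continuousAt_const
        (by simpa using hδ))
    have e3 : ∀ᶠ ε : ℝ in 𝓝[>] 0, C * ε < r * (1 - r ^ 2) := nhdsWithin_le_nhds
      ((continuous_const.mul continuous_id).continuousAt.eventually_lt continuousAt_const
        (by simpa using mul_pos hr0 (show 0 < 1 - r ^ 2 by nlinarith)))
    obtain ⟨ε, ⟨⟨h1, h2⟩, h3⟩, h4⟩ := (((e1.and e2).and e3).and self_mem_nhdsWithin).exists
    exact ⟨ε, h4, h1, h2, h3⟩
  -- The symmetry used is the one at a point `x` close to the origin on the segment to `y`. Its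
  -- derivative there is `-1`, so it sends `x + x` to within `O(ε ^ 2)` of the origin.
  set x : 𝔼 := (ε : ℂ) • y with hx
  have hxn : ‖x‖ = ε * ‖y‖ := by
    rw [hx, norm_smul, Complex.norm_real, Real.norm_of_nonneg hε0.le]
  have hxD : Metric.ball x δ ⊆ D := by
    refine (Metric.ball_subset_ball' ?_).trans hδD
    rw [dist_zero_right, hxn]; linarith
  have hxmem : x ∈ D := hxD (Metric.mem_ball_self hδ)
  obtain ⟨s, hsb, hsinv, hsx, hiso⟩ := hs.symmetric x hxmem
  refine ⟨s, hsb, ?_⟩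
  by_contra! hge
  have hsd : DifferentiableOn ℂ s D := hsb.2.2.1
  have hsm : MapsTo s D D := hsb.2.2.2.1
  have hderiv := fderiv_eq_neg_one_of_involution hDo hD.isBounded hxmem hsd hsm hsinv hsx hiso
  have hsmall : ‖s (x + x)‖ ≤ 4 * M * (‖x‖ / δ) ^ 2 := by
    have := norm_sub_sub_fderiv_le (z := x + x) (hsd.mono hxD) (fun w hw => hM _ (hsm (hxD hw)))
      (by simpa [Metric.mem_ball, dist_eq_norm, hxn] using hε2)
    simpa [hsx, hderiv] using this
  have hq : ((r⁻¹ : ℝ) : ℂ) • s y ∉ D := by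
    intro hmem
    have := gauge_lt_one_of_mem_of_isOpen hDo hmem
    rw [gauge_smul hD.balanced, Complex.norm_real, Real.norm_of_nonneg (by positivity),
      inv_mul_lt_one₀ hr0] at this
    linarith
  obtain ⟨l, hl1, hl⟩ := exists_continuousLinearMap_norm_lt_one hDo hD.convex hD.balanced h0 hq
  have hlq : l (s y) = r := by
    rw [map_smul, smul_eq_mul, Complex.ofReal_inv, inv_mul_eq_one₀ (by exact_mod_cast hr0.ne')]
      at hl1
    exact hl1.symm
  have hlnorm : ‖l‖ ≤ 1 / δ := by
    have := Complex.norm_fderiv_le_div_of_mapsTo_ball (f := l) (c := 0) (R₁ := δ) (R₂ := 1)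
      l.differentiable.differentiableOn (fun w hw => by
        simpa using (hl w (hδD (Metric.ball_subset_ball (by linarith) hw))).le) hδ
    simpa using this
  have hdisc : ∀ ζ ∈ Metric.ball (0 : ℂ) 1, (ζ / r) • y ∈ D := by
    intro ζ hζ
    have hset := setOfPred_gauge_lt_one_eq_self_of_isOpen hD.convex h0 hDo
    rw [← hset]
    change gauge D ((ζ / r) • y) < 1
    rw [gauge_smul hD.balanced, norm_div, Complex.norm_real, Real.norm_of_nonneg hr0.le, ← hr,
      div_mul_cancel₀ _ hr0.ne']
    exact mem_ball_zero_iff.1 hζ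
  have hrC : (r : ℂ) ≠ 0 := by exact_mod_cast hr0.ne'
  -- On the disc through `y`, the function `l ∘ s` has value `r` at `r` and is at most `C * ε ^ 2`
  -- at `2 * ε * r`, the parameter of `x + x`. The resulting bound `2 * ε * r * (1 - r ^ 2) ≤ 2 * C
  -- * ε ^ 2` contradicts the choice of `ε`.
  have key := le_of_mapsTo_unit_ball (f := fun ζ => l (s ((ζ / r) • y))) (b := 2 * ε * r) (r := r)
    (δ := C * ε ^ 2) (by positivity) (by nlinarith) hr1
    (l.differentiable.comp_differentiableOn
      (hsd.comp ((differentiable_id.div_const _).smul_const y).differentiableOn hdisc))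
    (fun ζ hζ => by simpa using (hl _ (hsm (hdisc ζ hζ))).le) ?_ ?_
  · nlinarith
  · have e : (((2 * ε * r : ℝ) : ℂ) / r) • y = x + x := by
      rw [hx, ← two_smul ℂ, smul_smul]
      congr 1
      push_cast
      field_simp
    simp only [e]
    refine (l.le_of_opNorm_le hlnorm _).trans ?_
    calc 1 / δ * ‖s (x + x)‖ ≤ 1 / δ * (4 * M * (‖x‖ / δ) ^ 2) := by gcongr
      _ = C * ε ^ 2 := by rw [hC, hxn]; ring
  · simp [div_self hrC, hlq, abs_of_pos hr0]

/-- The automorphism group of a convex balanced bounded symmetric domain is transitive. -/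
theorem exists_automorphism_zero_eq {D : Set 𝔼} (hD : IsBoundedConvexBalancedDomain D)
    (hs : IsBoundedSymmetricDomain D) {y : 𝔼} (hy : y ∈ D) :
    ∃ ψ : 𝔼 → 𝔼, IsBiholomorphism ψ D D ∧ ψ 0 = y := by
  have hDo : IsOpen D := hD.isDomainIn.isOpen
  have h0 : (0 : 𝔼) ∈ D := hD.zero_mem
  -- The gauge is minimised over the orbit of `y`: a minimising sequence of automorphisms has an
  -- automorphism as limit, so the minimum is attained, and a nonzero minimiser could be improved by
  -- a symmetry.
  set T : Set ℝ := {t | ∃ φ : 𝔼 → 𝔼, IsBiholomorphism φ D D ∧ gauge D (φ y) = t} with hT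
  have hTne : T.Nonempty := ⟨_, id, isBiholomorphism_id hDo, rfl⟩
  have hTbdd : BddBelow T := ⟨0, by rintro _ ⟨φ, -, rfl⟩; exact gauge_nonneg _⟩
  obtain ⟨u, -, hulim, huT⟩ := exists_seq_tendsto_sInf hTne hTbdd
  choose φ hφ hφu using huT
  choose χ hχ hχφ using fun k => (hφ k).exists_inverse
  set 𝒰 : Ultrafilter ℕ := hyperfilter ℕ
  have h𝒰 : (𝒰 : Filter ℕ) ≤ atTop := Nat.hyperfilter_le_atTop
  have hφi := IsBiholomorphism.eventuallyHolomorphicInto (l := (𝒰 : Filter ℕ)) hDo hφ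
  obtain ⟨g, -, hg⟩ := hφi.exists_limit hDo hD.isBounded
  have hgy : Tendsto (fun k => φ k y) 𝒰 (𝓝 (g y)) :=
    tendsto_apply_of_tendsto_prod (hg y hy) tendsto_const_nhds
  have hgauge : gauge D (g y) = sInf T := by
    have h1 := ((continuous_gauge hD.convex (hDo.mem_nhds h0)).tendsto (g y)).comp hgy
    refine tendsto_nhds_unique h1 ?_
    simpa only [Function.comp_def, hφu] using hulim.mono_left h𝒰
  -- The infimum is at most the gauge of `y`, which is below `1`, so the limit does not escape to
  -- the boundary.
  have hgD : g y ∈ D := by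
    rw [← setOfPred_gauge_lt_one_eq_self_of_isOpen hD.convex h0 hDo]
    change gauge D (g y) < 1
    rw [hgauge]
    exact (csInf_le hTbdd ⟨id, isBiholomorphism_id hDo, rfl⟩).trans_lt
      (gauge_lt_one_of_mem_of_isOpen hDo hy)
  obtain ⟨f₀, g₀, hf₀d, hg₀d, hf₀m, hg₀m, hinv, hf₀⟩ := exists_biholomorphic_limit hDo hD.convex
    hD.isBounded hDo hD.convex hD.isBounded hφi
    (IsBiholomorphism.eventuallyHolomorphicInto hDo hχ)
    (fun z hz => Eventually.of_forall fun k => (hχφ k).1 hz)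
    (fun z hz => Eventually.of_forall fun k => (hχφ k).2 hz) hy hgD hgy
  have hf₀y : f₀ y = g y := tendsto_nhds_unique (hf₀ y hy) hgy
  have hf₀b : IsBiholomorphism f₀ D D := ⟨hDo, hDo, hf₀d, hf₀m, g₀, hg₀d, hg₀m, hinv⟩
  have hzero : f₀ y = 0 := by
    by_contra hne
    obtain ⟨s, hsb, hlt⟩ := exists_automorphism_gauge_lt hD hs (hf₀m hy) hne
    have := csInf_le hTbdd ⟨s ∘ f₀, hsb.comp hf₀b, rfl⟩
    rw [Function.comp_apply, ← hgauge, ← hf₀y] at this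
    exact hlt.not_ge this
  exact ⟨g₀, ⟨hDo, hDo, hg₀d, hg₀m, f₀, hf₀d, hf₀m, hinv.symm⟩, hzero ▸ hinv.1 hy⟩

/-! ### Linearisation at the origin and the local inverse at the boundary -/

/-- Bounded convex balanced domains that are biholomorphic with the origin corresponding to the
origin are linearly equivalent. -/
theorem exists_linear_isBiholomorphism {D₁ D₂ : Set 𝔼} (hD₁ : IsBoundedConvexBalancedDomain D₁)
    (hD₂ : IsBoundedConvexBalancedDomain D₂) {f g : 𝔼 → 𝔼} (hf : DifferentiableOn ℂ f D₁)
    (hg : DifferentiableOn ℂ g D₂) (hfm : MapsTo f D₁ D₂) (hgm : MapsTo g D₂ D₁)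
    (hinv : InvOn g f D₁ D₂) (hf0 : f 0 = 0) :
    ∃ L : 𝔼 →ₗ[ℂ] 𝔼, IsBiholomorphism (fun z => L z) D₁ D₂ := by
  have ho₁ := hD₁.isDomainIn.isOpen
  have ho₂ := hD₂.isDomainIn.isOpen
  have hg0 : g 0 = 0 := by simpa [hf0] using hinv.1 hD₁.zero_mem
  have hfd := (hf.differentiableAt (ho₁.mem_nhds hD₁.zero_mem)).hasFDerivAt
  have hgd := (hg.differentiableAt (ho₂.mem_nhds hD₂.zero_mem)).hasFDerivAt
  have hgf : ∀ v, fderiv ℂ g 0 (fderiv ℂ f 0 v) = v := fun v => by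
    have h1 : HasFDerivAt (g ∘ f) ((fderiv ℂ g 0).comp (fderiv ℂ f 0)) 0 :=
      HasFDerivAt.comp 0 (by rwa [hf0]) hfd
    have h2 : HasFDerivAt (g ∘ f) (ContinuousLinearMap.id ℂ 𝔼) 0 :=
      (hasFDerivAt_id 0).congr_of_eventuallyEq (by
        filter_upwards [ho₁.mem_nhds hD₁.zero_mem] with z hz using hinv.1 hz)
    exact DFunLike.congr_fun (h1.unique h2) v
  have hfg : ∀ v, fderiv ℂ f 0 (fderiv ℂ g 0 v) = v := fun v => by
    have h1 : HasFDerivAt (f ∘ g) ((fderiv ℂ f 0).comp (fderiv ℂ g 0)) 0 :=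
      HasFDerivAt.comp 0 (by rwa [hg0]) hgd
    have h2 : HasFDerivAt (f ∘ g) (ContinuousLinearMap.id ℂ 𝔼) 0 :=
      (hasFDerivAt_id 0).congr_of_eventuallyEq (by
        filter_upwards [ho₂.mem_nhds hD₂.zero_mem] with z hz using hinv.2 hz)
    exact DFunLike.congr_fun (h1.unique h2) v
  -- The derivatives of `f` and `g` at the origin are mutually inverse, and each maps its domain
  -- into the other. Linearity of `f` itself is not needed.
  exact ⟨fderiv ℂ f 0, ho₁, ho₂, (fderiv ℂ f 0).differentiable.differentiableOn,
    mapsTo_fderiv_zero_of_balanced ho₁ hD₁.balanced ho₂ hD₂.convex hD₂.balanced hf hfm hf0,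
    fderiv ℂ g 0, (fderiv ℂ g 0).differentiable.differentiableOn,
    mapsTo_fderiv_zero_of_balanced ho₂ hD₂.balanced ho₁ hD₁.convex hD₁.balanced hg hgm hg0,
    fun z _ => hgf z, fun z _ => hfg z⟩

/-- A locally biholomorphic map near a boundary point `p` that takes `D₁` into the convex domain
`D₂` and boundary to boundary has a local inverse that takes `D₂` into `D₁`. -/
theorem exists_ball_mapsTo_inverse {D₁ D₂ U : Set 𝔼} {F g : 𝔼 → 𝔼} {p : 𝔼}
    (hD₁ : IsOpen D₁) (hD₂ : IsOpen D₂) (hconv : Convex ℝ D₂) (hU : IsOpen U) (hpU : p ∈ U)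
    (hp : p ∈ frontier D₁) (hFU : IsOpen (F '' U)) (hF : ContinuousOn F U)
    (hgd : ContinuousOn g (F '' U)) (hg : InvOn g F U (F '' U)) (hFD : MapsTo F (U ∩ D₁) D₂)
    (hFbdry : MapsTo F (U ∩ frontier D₁) (frontier D₂)) :
    ∃ V, IsOpen V ∧ F p ∈ V ∧ V ⊆ F '' U ∧ MapsTo g (V ∩ D₂) D₁ := by
  obtain ⟨η, hη, hηU⟩ := Metric.isOpen_iff.1 hFU (F p) (mem_image_of_mem F hpU)
  refine ⟨Metric.ball (F p) η, Metric.isOpen_ball, Metric.mem_ball_self hη, hηU, ?_⟩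
  set B := Metric.ball (F p) η ∩ D₂ with hB
  have hBU : B ⊆ F '' U := inter_subset_left.trans hηU
  have hBo : IsOpen B := Metric.isOpen_ball.inter hD₂
  have hBc : IsPreconnected B := ((convex_ball (F p) η).inter hconv).isPreconnected
  have hgmU : ∀ w ∈ B, g w ∈ U := fun w hw => by
    obtain ⟨z, hz, rfl⟩ := hBU hw
    rwa [hg.1 hz]
  have hopen : IsOpen (B ∩ g ⁻¹' D₁) := (hgd.mono hBU).isOpen_inter_preimage hBo hD₁
  have hne : (B ∩ (B ∩ g ⁻¹' D₁)).Nonempty := by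
    have h1 : ∃ᶠ z in 𝓝 p, z ∈ D₁ := mem_closure_iff_frequently.1 hp.1
    have h2 : ∀ᶠ z in 𝓝 p, z ∈ U ∧ F z ∈ Metric.ball (F p) η :=
      (hU.eventually_mem hpU).and
        ((hF.continuousAt (hU.mem_nhds hpU)).eventually (Metric.ball_mem_nhds _ hη))
    obtain ⟨z, hzD, hzU, hzB⟩ := (h1.and_eventually h2).exists
    have hzB' : F z ∈ B := ⟨hzB, hFD ⟨hzU, hzD⟩⟩
    exact ⟨F z, hzB', hzB', by rw [mem_preimage, hg.1 hzU]; exact hzD⟩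
  -- The right-hand side is open and nonempty in the connected set `B`. It is also closed in `B`: a
  -- limit point outside it would be sent by `g` to the boundary of `D₁`, hence would itself lie on
  -- the boundary of `D₂`, but `B ⊆ D₂`.
  have hsub : B ⊆ B ∩ g ⁻¹' D₁ := by
    refine hBc.subset_of_closure_inter_subset hopen hne ?_
    rintro w ⟨hwcl, hwB⟩
    refine ⟨hwB, ?_⟩
    have hcl : g w ∈ closure D₁ :=
      (hgd.continuousAt (hFU.mem_nhds (hBU hwB))).continuousWithinAt.mem_closure
        hwcl fun v hv => hv.2
    by_contra hw
    have hfr : g w ∈ frontier D₁ := ⟨hcl, by rwa [hD₁.interior_eq]⟩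
    have := hFbdry ⟨hgmU w hwB, hfr⟩
    rw [hg.2 (hBU hwB)] at this
    exact (hD₂.frontier_eq ▸ this).2 hwB.2
  exact fun w hw => (hsub hw).2

end Biholomorphisms

/-! ### The scaling argument -/

theorem theorem1p2 {n : ℕ} (D₁ D₂ : Set (EuclideanSpace ℂ (Fin n)))
    (hD₁ : IsBoundedConvexBalancedDomain D₁)
    (hAut : ¬ IsCompact (automorphisms D₁))
    (p : EuclideanSpace ℂ (Fin n))
    (hp : IsBoundaryOrbitAccumulationPoint D₁ p)
    (hD₂ : IsBoundedConvexBalancedDomain D₂)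
    (hD₂symm : IsBoundedSymmetricDomain D₂)
    (U : Set (EuclideanSpace ℂ (Fin n))) (hU : IsOpen U) (hpU : p ∈ U)
    (F : EuclideanSpace ℂ (Fin n) → EuclideanSpace ℂ (Fin n))
    (hF : IsBiholomorphism F U (F '' U))
    (hFD : MapsTo F (U ∩ D₁) D₂)
    (hFbdry : MapsTo F (U ∩ frontier D₁) (frontier D₂))
    (hpeak : IsPeakPoint D₁ p ∨ IsPeakPoint D₂ (F p)) :
    ∃ L : EuclideanSpace ℂ (Fin n) →ₗ[ℂ] EuclideanSpace ℂ (Fin n),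
      IsBiholomorphism (fun z => L z) D₁ D₂ := by
  obtain ⟨hpD, a, ha, φ, hφ, hφp⟩ := hp
  obtain ⟨-, hFU, hFd, -, g, hgd, hgm, hg⟩ := hF
  have ho₁ := hD₁.isDomainIn.isOpen
  have ho₂ := hD₂.isDomainIn.isOpen
  obtain ⟨V, hVo, hpV, hVU, hVg⟩ := exists_ball_mapsTo_inverse ho₁ ho₂ hD₂.convex hU hpU hpD hFU
    hFd.continuousOn hgd.continuousOn hg hFD hFbdry
  have hgFp : g (F p) = p := hg.1 hpU
  have hFcl : MapsTo F (closure D₁ ∩ U) (closure D₂) := fun z hz => by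
    by_cases h : z ∈ D₁
    · exact subset_closure (hFD ⟨hz.2, h⟩)
    · exact (hFbdry ⟨hz.2, hz.1, by rwa [ho₁.interior_eq]⟩).1
  have hgcl : MapsTo g (closure D₂ ∩ V) (closure D₁) := fun w hw =>
    (hgd.continuousOn.continuousAt (hFU.mem_nhds (hVU hw.2))).continuousWithinAt.mem_closure
      (hVo.inter_closure ⟨hw.2, hw.1⟩) fun v hv => hVg hv
  -- Composition with `g` or `F` carries a peak function across the boundary point, so either
  -- alternative of `hpeak` yields local peak functions on both sides.
  obtain ⟨⟨W₁, h₁, hh₁⟩, ⟨W₂, h₂, hh₂⟩⟩ :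
      (∃ W h, IsLocalPeakFunction D₁ p W h) ∧ ∃ W h, IsLocalPeakFunction D₂ (F p) W h := by
    rcases hpeak with ⟨-, h, hd, hc, h1, hlt⟩ | ⟨-, h, hd, hc, h1, hlt⟩
    · refine ⟨⟨univ, h, isOpen_univ, mem_univ _, by simpa using hd, by simpa using hc, h1,
        by simpa using hlt⟩, V, h ∘ g, hVo, hpV, ?_, ?_, by simp [hgFp, h1], ?_⟩
      · exact hd.comp (hgd.mono (inter_subset_right.trans hVU)) fun w hw => hVg ⟨hw.2, hw.1⟩
      · exact hc.comp (hgd.continuousOn.mono (inter_subset_right.trans hVU)) hgcl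
      · intro w hw hne
        refine hlt _ (hgcl hw) fun h => hne ?_
        rw [← h, hg.2 (hVU hw.2)]
    · refine ⟨⟨U, h ∘ F, hU, hpU, ?_, ?_, h1, ?_⟩, univ, h, isOpen_univ, mem_univ _,
        by simpa using hd, by simpa using hc, h1, by simpa using hlt⟩
      · exact hd.comp (hFd.mono inter_subset_right) fun z hz => hFD ⟨hz.2, hz.1⟩
      · exact hc.comp (hFd.continuousOn.mono inter_subset_right) hFcl
      · intro z hz hne
        exact hlt _ (hFcl hz) fun h => hne (hg.1.injOn hz.2 hpU h)
  set 𝒰 : Ultrafilter ℕ := hyperfilter ℕ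
  have h𝒰 : (𝒰 : Filter ℕ) ≤ atTop := Nat.hyperfilter_le_atTop
  have hφi := IsBiholomorphism.eventuallyHolomorphicInto (l := (𝒰 : Filter ℕ)) ho₁ hφ
  have hφlim : ∀ z ∈ D₁, Tendsto (fun q : ℕ × EuclideanSpace ℂ (Fin n) => φ q.1 q.2)
      ((𝒰 : Filter ℕ) ×ˢ 𝓝 z) (𝓝 p) := fun z hz =>
    hh₁.tendsto_prod ho₁ hD₁.convex.isPreconnected hD₁.isBounded hφi ha (hφp.mono_left h𝒰) hz
  have hφpt : ∀ z ∈ D₁, Tendsto (fun k => φ k z) 𝒰 (𝓝 p) := fun z hz =>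
    tendsto_apply_of_tendsto_prod (hφlim z hz) tendsto_const_nhds
  have hφD : ∀ k, ∀ z ∈ D₁, φ k z ∈ D₁ := fun k => (hφ k).2.2.2.1
  choose φ' hφ' hφinv using fun k => (hφ k).exists_inverse
  have hψex : ∀ k, ∃ ψ, IsBiholomorphism ψ D₂ D₂ ∧ (F (φ k 0) ∈ D₂ → ψ 0 = F (φ k 0)) := by
    intro k
    by_cases h : F (φ k 0) ∈ D₂
    · obtain ⟨ψ, hψ, hψ0⟩ := exists_automorphism_zero_eq hD₂ hD₂symm h
      exact ⟨ψ, hψ, fun _ => hψ0⟩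
    · exact ⟨id, isBiholomorphism_id ho₂, fun h' => absurd h' h⟩
  choose ψ hψ hψ0 using hψex
  choose ψ' hψ' hψinv using fun k => (hψ k).exists_inverse
  have hφU : ∀ z ∈ D₁, ∀ᶠ k in (𝒰 : Filter ℕ), φ k z ∈ U := fun z hz =>
    (hφpt z hz).eventually (hU.mem_nhds hpU)
  have hψ0' : ∀ᶠ k in (𝒰 : Filter ℕ), ψ k 0 = F (φ k 0) := by
    filter_upwards [hφU 0 hD₁.zero_mem] with k hk
    exact hψ0 k (hFD ⟨hk, hφD k 0 hD₁.zero_mem⟩)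
  have hψi := IsBiholomorphism.eventuallyHolomorphicInto (l := (𝒰 : Filter ℕ)) ho₂ hψ
  have hψ0lim : Tendsto (fun k => ψ k 0) 𝒰 (𝓝 (F p)) :=
    ((hFd.continuousOn.continuousAt (hU.mem_nhds hpU)).tendsto.comp
      (hφpt 0 hD₁.zero_mem)).congr' (hψ0'.mono fun k hk => hk.symm)
  have hψlim : ∀ w ∈ D₂, Tendsto (fun q : ℕ × EuclideanSpace ℂ (Fin n) => ψ q.1 q.2)
      ((𝒰 : Filter ℕ) ×ˢ 𝓝 w) (𝓝 (F p)) := fun w hw =>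
    hh₂.tendsto_prod ho₂ hD₂.convex.isPreconnected hD₂.isBounded hψi hD₂.zero_mem hψ0lim hw
  have hψV : ∀ w ∈ D₂, ∀ᶠ k in (𝒰 : Filter ℕ), ψ k w ∈ V := fun w hw =>
    (tendsto_apply_of_tendsto_prod (hψlim w hw) tendsto_const_nhds).eventually (hVo.mem_nhds hpV)
  have hψD : ∀ k, ∀ w ∈ D₂, ψ k w ∈ D₂ := fun k => (hψ k).2.2.2.1
  -- These are the rescaled maps `(ψ k)⁻¹ ∘ F ∘ φ k` and, in `hHi`, their asymptotic inverses. The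
  -- normalisation of `ψ k` makes the former fix the origin eventually, which prevents degeneration
  -- in the limit.
  have hGi := hφi.comp_comp hφlim (hU.mem_nhds hpU) (hFd.mono inter_subset_left) hFD
    (ψ := ψ') fun k => ⟨(hψ' k).2.2.1, (hψ' k).2.2.2.1⟩
  have hHi := hψi.comp_comp hψlim (hVo.mem_nhds hpV)
    (hgd.mono (inter_subset_left.trans hVU)) hVg
    (ψ := φ') fun k => ⟨(hφ' k).2.2.1, (hφ' k).2.2.2.1⟩
  have hG0 : ∀ᶠ k in (𝒰 : Filter ℕ), ψ' k (F (φ k 0)) = 0 := by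
    filter_upwards [hψ0'] with k hk
    rw [← hk, (hψinv k).1 hD₂.zero_mem]
  have hG0lim : Tendsto (fun k => ψ' k (F (φ k 0))) 𝒰 (𝓝 0) :=
    tendsto_const_nhds.congr' (hG0.mono fun k hk => hk.symm)
  obtain ⟨f₀, g₀, hf₀d, hg₀d, hf₀m, hg₀m, hinv, hf₀⟩ := exists_biholomorphic_limit
    (f := fun k z => ψ' k (F (φ k z))) (g := fun k w => φ' k (g (ψ k w)))
    ho₁ hD₁.convex hD₁.isBounded ho₂ hD₂.convex hD₂.isBounded hGi hHi
    (fun z hz => by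
      filter_upwards [hφU z hz] with k hk
      rw [(hψinv k).2 (hFD ⟨hk, hφD k z hz⟩), hg.1 hk, (hφinv k).1 hz])
    (fun w hw => by
      filter_upwards [hψV w hw] with k hk
      rw [(hφinv k).2 (hVg ⟨hk, hψD k w hw⟩), hg.2 (hVU hk), (hψinv k).1 hw])
    hD₁.zero_mem hD₂.zero_mem hG0lim
  exact exists_linear_isBiholomorphism hD₁ hD₂ hf₀d hg₀d hf₀m hg₀m hinv
    (tendsto_nhds_unique (hf₀ 0 hD₁.zero_mem) hG0lim)
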